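/- **Setting.** For $A_0,T_0\in(0,\infty]$ put $\Omega=(0,A_0)\times[0,T_0)$, with points $(x,s)$. For $\eta>0$, positive functions $u,v$ on $\Omega$, and an integer $r\ge 0$ let $$[u:v]_\eta=\sup\Big\{\Big(\tfrac{u(x,s)}{v(x,s)}\Big)^{\pm1} : (x,s)\in\Omega,\ s\le\eta\text{ or }x\le\eta\Big\},\qquad K_r(u)=\frac{\max_{a+b=r}\sup_\Omega|\partial_x^a\partial_s^b u|}{\inf_\Omega u}\in[0,\infty],$$ with $0/0=0$. Fix an integer $\alpha\ge0$. A PDE of order $\alpha$ is a family, parametrized by $\epsilon>0$, of real polynomials $P(\epsilon,u,u_x,u_s,\dots,u_{\alpha s})$ in the partial derivatives of $u$ of order at most $\alpha$. The symbol $*\in\{fin,\infty\}$ specifies the domains considered: all $A_0,T_0\in(0,\infty]$ for $*=fin$; $A_0=\infty$ and all $T_0\in(0,\infty]$ for $*=\infty$. **Relations.** Let $M',c',D,L'\ge1$ be constants. $P\sim_*^{e^e}Q$ holds in the class $(M',c',D,L';\alpha)$, respectively $P\sim_*^{e}Q$ holds in the class $(M',1,D,L';\alpha)$, if there are constants $C,C'>0$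 such that for all domains $\Omega$ of kind $*$, all $\epsilon>0$ and all positive $C^{\alpha+1}$ solutions $u,v:\Omega\to(0,\infty)$ of $P(\epsilon,u,\dots,u_{\alpha s})=0$ and $Q(\epsilon,v,\dots,v_{\alpha s})=0$ with $$0<L'\epsilon\le\min\Big(\frac1{C\max(K_{\alpha+1}(u),K_{\alpha+1}(v))},A_0,T_0,C'\Big),$$ one has for all $(x,s)\in\Omega$, with $y=\epsilon^{-D}(x+s+1)$, $$\Big(\frac{u(x,s)}{v(x,s)}\Big)^{\pm1}\le M'^{\,c'^{\,y}}\,\big([u:v]_{L'\epsilon}\big)^{c'^{\,y}},\qquad\text{respectively}\qquad \Big(\frac{u(x,s)}{v(x,s)}\Big)^{\pm1}\le M'^{\,y}\,[u:v]_{L'\epsilon}.$$ **Relatively elementary functions.** A relative $(\max,+)$-function, with a presentation, is $$\varphi(\bar x)=\max_{1\le i\le m_1}(\alpha_i+\bar a_i\bar x)-\max_{1\le j\le m_2}(\beta_j+\bar b_j\bar x),\qquad \bar x\in\mathbb R^n,$$ with $m_1,m_2\ge1$, $\bar a_i,\bar b_j\in\mathbb Z^n$ and $\alpha_i,\beta_j\in\mathbb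 R$ (terms may be repeated). Its relatively elementary function is $f_t(\bar z)=\sum_i t^{\alpha_i}\bar z^{\bar a_i}\big/\sum_j t^{\beta_j}\bar z^{\bar b_j}$ on $\mathbb R^n_{>0}$. Put $M_f=m_1m_2$ and let $c_f\ge1$ be the maximum of $1$ and the best Lipschitz constant of $\varphi$ for the maximum norm on $\mathbb R^n$. Two relatively elementary functions are tropically equivalent if their $(\max,+)$-functions are equal as maps. **Approximation.** Approximation data consist of $n$ distinct shifts $(a_i,b_i)\in\mathbb Z^2$, each with either $b_i=1$ and $a_i\le0$, or $b_i\le0$, and of integers $m$ and $p,q\ge1$. They stand for the dynamics $z_{N+1}^{t+1}=f(z_{N+a_1}^{t+b_1},\dots,z_{N+a_n}^{t+b_n})$ with the scaling $z_N^t=\epsilon^mu(x,s)$, $x=\epsilon^pN$, $s=\epsilon^qt$. Put $$l=\max_i(0,-a_i),\quad d=\max_i(0,-b_i),\quad L=\max(l,d),\quad D=\max(p,q),\quad k=\max_i(1,a_i).$$ Let $u_{(a,b)}=u(x+a\epsilon^p,s+b\epsilon^q)$, and let $\tau_{(a,b)}$ be the Taylor polynomial of $u$ of order $\alpha$ at $(x,s)$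 evaluated at $(x+a\epsilon^p,s+b\epsilon^q)$. The PDE $P$ is approximated by $f$ with these data in $\mathbf{PDE}_2^*$ if * for $*=fin$ one has $a_i\le1$ for all $i$; and * there are polynomials $\kappa,h$ in $n$ variables with $h>0$ and $f=\kappa/h$ on $\mathbb R^n_{>0}$, a positive function $H(\epsilon,\bar z)$ on $(0,1)\times\mathbb R_{>0}^n$ and a constant $C\ge0$ such that the following holds for all domains $\Omega$ of kind $*$, all $0<\epsilon<1$, all positive $C^{\alpha+1}$ functions $u$ on $\Omega$ and all $(x,s)\in\Omega$ for which $(x+\epsilon^p,s+\epsilon^q)$ and all $(x+a_i\epsilon^p,s+b_i\epsilon^q)$ lie in $\Omega$. Define $\mathbf F$ and $\mathbf F^1$ by $$\mathbf F=\frac{\epsilon^m\tau_{(1,1)}\,h\big((\epsilon^m\tau_{(a_i,b_i)})_i\big)-\kappa\big((\epsilon^m\tau_{(a_i,b_i)})_i\big)}{\epsilon^m\,h\big((\epsilon^mu_{(a_i,b_i)})_i\big)},\qquad \epsilon^mu_{(1,1)}-f\big((\epsilon^mu_{(a_i,b_i)})_i\big)=\epsilon^m\mathbf F+\epsilon^{m+1}\mathbf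 F^1 .$$ Then $\mathbf F=P(\epsilon,u,u_x,\dots,u_{\alpha s})(x,s)\big/H\big(\epsilon,(\epsilon^mu_{(a_i,b_i)})_i\big)$, and there are points $\xi_{ab}$ $(a+b=\alpha+1)$ on the segments from $(x,s)$ to these shifted points with $$|\mathbf F^1|\le C\sum_{a+b=\alpha+1}|\partial_x^a\partial_s^bu(\xi_{ab})|.$$ **Corollary 3.2.** Let $t>1$, and let $f=f_t$ and $g=g_t$ be relatively elementary functions of $n$ variables which are increasing on $\mathbb R^n_{>0}$ and mutually tropically equivalent. Let $*\in\{fin,\infty\}$, and let $P,Q\in\mathbf{PDE}_2^*$ be PDEs of order $\alpha\ge0$ approximated by $f$ and $g$ respectively, with the same approximation data. Put $M=\max(M_f,M_g)$ and $c=\max(c_f,c_g)$, and let $L,k,D$ be the numbers of the approximation data. * If $c>1$, then $P\sim_*^{e^e}Q$ in the class $\big((2M)^{8/(c-1)},\,c^k,\,D,\,L+1;\,\alpha\big)$. * If $c=1$, then $P\sim_*^{e}Q$ in the class $\big((2M)^{8k},\,1,\,D,\,L+1;\,\alpha\big)$. -/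

import Mathlib

open scoped ENNReal

noncomputable section

namespace RoughPDE

/-! ### Domains, derivatives, rates -/

/-- The domain `(0, A) × [0, T)` of pairs `(x, s)`, where `A, T ∈ [0, ∞]`. -/
def domain (A T : ℝ≥0∞) : Set (ℝ × ℝ) :=
  {p | 0 < p.1 ∧ ENNReal.ofReal p.1 < A ∧ 0 ≤ p.2 ∧ ENNReal.ofReal p.2 < T}

/-- The partial derivative `∂_x^a ∂_s^b u` at `p`, relative to the set `Ω`
(so it is one-sided at boundary points `s = 0` that belong to `Ω`). -/
def pderiv (Ω : Set (ℝ × ℝ)) (u : ℝ × ℝ → ℝ) (ab : ℕ × ℕ) (p : ℝ × ℝ) : ℝ :=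
  iteratedFDerivWithin ℝ (ab.1 + ab.2) u Ω p
    (fun i => if (i : ℕ) < ab.1 then ((1 : ℝ), (0 : ℝ)) else ((0 : ℝ), (1 : ℝ)))

/-- `u` is a positive function of class `C^r` on `Ω`. -/
def IsPositiveOfClass (r : ℕ) (Ω : Set (ℝ × ℝ)) (u : ℝ × ℝ → ℝ) : Prop :=
  ContDiffOn ℝ r u Ω ∧ ∀ p ∈ Ω, 0 < u p

/-- The two-sided quotient `max (u/v, v/u)` at a point; an upper bound `B` for it says
that `(u/v)^{±1} ≤ B`. -/
def ratio (u v : ℝ × ℝ → ℝ) (p : ℝ × ℝ) : ℝ≥0∞ :=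
  max (ENNReal.ofReal (u p / v p)) (ENNReal.ofReal (v p / u p))

/-- The initial rate `[u : v]_η`: the supremum of `(u/v)^{±1}` over the points of the domain with
`s ≤ η` or `x ≤ η`. -/
def initialRate (A T : ℝ≥0∞) (u v : ℝ × ℝ → ℝ) (η : ℝ) : ℝ≥0∞ :=
  ⨆ p ∈ {p ∈ domain A T | p.2 ≤ η ∨ p.1 ≤ η}, ratio u v p

/-- The uniform norm of all partial derivatives of `u` of order exactly `r`. -/
def derivNorm (r : ℕ) (Ω : Set (ℝ × ℝ)) (u : ℝ × ℝ → ℝ) : ℝ≥0∞ :=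
  ⨆ ab ∈ Finset.HasAntidiagonal.antidiagonal r, ⨆ p ∈ Ω, ENNReal.ofReal |pderiv Ω u ab p|

/-- The higher derivative rate `K_r(u) = ‖u‖_r / inf u` in `[0, ∞]`. It is `∞` if
`inf u = 0 < ‖u‖_r`, and `0` whenever `‖u‖_r = 0`. -/
def derivRate (r : ℕ) (Ω : Set (ℝ × ℝ)) (u : ℝ × ℝ → ℝ) : ℝ≥0∞ :=
  derivNorm r Ω u / ⨅ p ∈ Ω, ENNReal.ofReal (u p)

/-! ### Families of polynomial PDEs and their solutions -/

/-- Index `(a, b)` of a derivative `∂_x^a ∂_s^b u` of order at most `α`. -/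
abbrev JetIndex (α : ℕ) : Type := {ab : ℕ × ℕ // ab.1 + ab.2 ≤ α}

/-- A family, parametrized by `ε > 0`, of real polynomials in
`u, u_x, u_s, …, u_{αx}, …, u_{αs}`. Polynomials in `ε` and the derivatives are the special case
of polynomial dependence on `ε`. -/
abbrev PDEFamily (α : ℕ) : Type := ℝ → MvPolynomial (JetIndex α) ℝ

/-- The value `P(ε, u, u_x, u_s, …, u_{αs})` at the point `p`. -/
def PDEFamily.value {α : ℕ} (P : PDEFamily α) (ε : ℝ) (Ω : Set (ℝ × ℝ)) (u : ℝ × ℝ → ℝ)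
    (p : ℝ × ℝ) : ℝ :=
  MvPolynomial.eval (fun ab : JetIndex α => pderiv Ω u ab.1 p) (P ε)

/-- `u` is a positive `C^{α+1}` solution of `P(ε, u, u_x, …, u_{αs}) = 0` on `Ω`. -/
def IsPositiveSolution {α : ℕ} (P : PDEFamily α) (ε : ℝ) (Ω : Set (ℝ × ℝ))
    (u : ℝ × ℝ → ℝ) : Prop :=
  IsPositiveOfClass (α + 1) Ω u ∧ ∀ p ∈ Ω, P.value ε Ω u p = 0

/-! ### The analytic relations -/

/-- The two kinds `fin`, `∞` of domains of solutions. -/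
inductive DomainKind where
  | fin : DomainKind
  | infty : DomainKind

/-- Which widths `A ∈ (0, ∞]` are considered: all of them for `fin`, only `∞` for `infty`. -/
def DomainKind.Allows : DomainKind → ℝ≥0∞ → Prop
  | .fin, A => 0 < A
  | .infty, A => A = ⊤

/-- The two growth types: `e` (exponential) and `e^e` (double exponential). -/
inductive GrowthKind where
  | e : GrowthKind
  | ee : GrowthKind

/-- The bound in the asymptotic estimate, where `R` is the initial rate and `y` stands for
`ε^{-D} (x + s + 1)`. -/
def GrowthKind.bound (M c : ℝ) (R : ℝ≥0∞) (y : ℝ) : GrowthKind → ℝ≥0∞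
  | .e => ENNReal.ofReal (M ^ y) * R
  | .ee => ENNReal.ofReal (M ^ (c ^ y)) * R ^ (c ^ y)

/-- `P ∼_*^+ Q` in the class `(M, c, D, L; α)`. For exponential growth the class has `c = 1`. -/
def RelatedIn (kind : DomainKind) (growth : GrowthKind) (M c D L : ℝ) {α : ℕ}
    (P Q : PDEFamily α) : Prop :=
  1 ≤ M ∧ 1 ≤ c ∧ 1 ≤ D ∧ 1 ≤ L ∧ (growth = .e → c = 1) ∧
  ∃ C C' : ℝ, 0 < C ∧ 0 < C' ∧
    ∀ A T : ℝ≥0∞, kind.Allows A → 0 < T →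
    ∀ ε : ℝ, 0 < ε →
    ∀ u v : ℝ × ℝ → ℝ,
      IsPositiveSolution P ε (domain A T) u →
      IsPositiveSolution Q ε (domain A T) v →
      ENNReal.ofReal (L * ε) ≤
        min (1 / (ENNReal.ofReal C *
            max (derivRate (α + 1) (domain A T) u) (derivRate (α + 1) (domain A T) v)))
          (min A (min T (ENNReal.ofReal C'))) →
      ∀ p ∈ domain A T,
        ratio u v p ≤
          growth.bound M c (initialRate A T u v (L * ε)) (ε ^ (-D) * (p.1 + p.2 + 1))

/-! ### Relative `(max, +)`-functions and relatively elementary functions -/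

/-- A presentation of a relative `(max, +)`-function
`φ(x) = max_i (α_i + a_i x) - max_j (β_j + b_j x)` of `n` variables. Terms may be repeated. -/
structure RelMaxPlus (n : ℕ) where
  numTerms : ℕ
  denTerms : ℕ
  numTerms_pos : 0 < numTerms
  denTerms_pos : 0 < denTerms
  numCoeff : Fin numTerms → ℝ
  numExp : Fin numTerms → Fin n → ℤ
  denCoeff : Fin denTerms → ℝ
  denExp : Fin denTerms → Fin n → ℤ

namespace RelMaxPlus

variable {n : ℕ}

/-- The `(max, +)`-function itself (the suprema are maxima over finite nonempty index sets). -/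
def trop (φ : RelMaxPlus n) (x : Fin n → ℝ) : ℝ :=
  (⨆ i, (φ.numCoeff i + ∑ j, (φ.numExp i j : ℝ) * x j)) -
    ⨆ i, (φ.denCoeff i + ∑ j, (φ.denExp i j : ℝ) * x j)

/-- The corresponding relatively elementary function `f_t`. -/
def relElem (φ : RelMaxPlus n) (t : ℝ) (z : Fin n → ℝ) : ℝ :=
  (∑ i, t ^ φ.numCoeff i * ∏ j, z j ^ φ.numExp i j) /
    ∑ i, t ^ φ.denCoeff i * ∏ j, z j ^ φ.denExp i j

/-- The number of components `M_f`. -/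
def components (φ : RelMaxPlus n) : ℕ := φ.numTerms * φ.denTerms

/-- The Lipschitz constant `c_f ≥ 1`: the best Lipschitz constant of the `(max, +)`-function for the
maximum norm on `ℝⁿ`, replaced by `1` if it is smaller. -/
def lipConst (φ : RelMaxPlus n) : ℝ :=
  max 1 (sInf {K : ℝ | 0 ≤ K ∧ ∀ x y, |φ.trop x - φ.trop y| ≤ K * ‖x - y‖})

/-- The relatively elementary functions of `φ` and `ψ` are tropically equivalent. -/
def TropEquiv (φ ψ : RelMaxPlus n) : Prop := φ.trop = ψ.trop

/-- `f_t` is increasing on the positive orthant. -/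
def IsIncreasing (φ : RelMaxPlus n) (t : ℝ) : Prop :=
  MonotoneOn (φ.relElem t) {z | ∀ i, 0 < z i}

end RelMaxPlus

/-! ### Approximation of PDEs by discrete dynamics -/

/-- Approximation data for a dynamics `z_{N+1}^{t+1} = f(…)` in `n` variables. The variable number
`i` is `z_{N+a}^{t+b}` with `(a, b) = shift i`: either it lies in the row `t + 1` and `a ≤ 0`, or it
lies in a row `t, t - 1, …`. The scaling is `ε^m u(x, s) = z_N^t`, `x = ε^p N`, `s = ε^q t`. -/
structure ApproxData (n : ℕ) where
  shift : Fin n → ℤ × ℤ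
  shift_injective : Function.Injective shift
  shift_mem : ∀ i, ((shift i).2 = 1 ∧ (shift i).1 ≤ 0) ∨ (shift i).2 ≤ 0
  m : ℤ
  p : ℕ
  q : ℕ
  one_le_p : 1 ≤ p
  one_le_q : 1 ≤ q

namespace ApproxData

variable {n : ℕ}

/-- `l = max (l_0, …, l_{d+1})`, how far the variables reach to the left of `N`. -/
def l (S : ApproxData n) : ℕ := Finset.univ.sup fun i => (-(S.shift i).1).toNat

/-- `d`, how far the variables reach into the past of `t`. -/
def d (S : ApproxData n) : ℕ := Finset.univ.sup fun i => (-(S.shift i).2).toNat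

/-- `k = max (k_1, …, k_{d+1})`, how far the variables reach to the right of `N`, counted as `1`
if no variable does. -/
def k (S : ApproxData n) : ℕ := max 1 (Finset.univ.sup fun i => (S.shift i).1.toNat)

/-- `L = max (l, d)`. -/
def L (S : ApproxData n) : ℕ := max S.l S.d

/-- `D = max (p, q)`. -/
def D (S : ApproxData n) : ℕ := max S.p S.q

/-- The dynamics is consistent: `k_1, …, k_{d+1} ≤ 1`. -/
def Consistent (S : ApproxData n) : Prop := ∀ i, (S.shift i).1 ≤ 1

/-- The point `(x + a ε^p, s + b ε^q)` for `x = (x, s)` and `σ = (a, b)`. -/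
def pt (S : ApproxData n) (ε : ℝ) (x : ℝ × ℝ) (σ : ℤ × ℤ) : ℝ × ℝ :=
  (x.1 + σ.1 * ε ^ S.p, x.2 + σ.2 * ε ^ S.q)

/-- The Taylor polynomial of order `α` of `u` at `x = (x, s)`, evaluated at
`(x + a ε^p, s + b ε^q)` for `σ = (a, b)`. -/
def taylor (S : ApproxData n) (α : ℕ) (ε : ℝ) (Ω : Set (ℝ × ℝ)) (u : ℝ × ℝ → ℝ) (x : ℝ × ℝ)
    (σ : ℤ × ℤ) : ℝ :=
  ∑ r ∈ Finset.range (α + 1), ∑ ab ∈ Finset.HasAntidiagonal.antidiagonal r,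
    (σ.1 * ε ^ S.p) ^ ab.1 * (σ.2 * ε ^ S.q) ^ ab.2 / (ab.1.factorial * ab.2.factorial) *
      pderiv Ω u ab x

/-- The arguments `ε^m u(x + a ε^p, s + b ε^q)` that are inserted into `f`. -/
def args (S : ApproxData n) (ε : ℝ) (u : ℝ × ℝ → ℝ) (x : ℝ × ℝ) : Fin n → ℝ :=
  fun i => ε ^ S.m * u (S.pt ε x (S.shift i))

/-- The same arguments with `u` replaced by its Taylor polynomials of order `α`. -/
def taylorArgs (S : ApproxData n) (α : ℕ) (ε : ℝ) (Ω : Set (ℝ × ℝ)) (u : ℝ × ℝ → ℝ)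
    (x : ℝ × ℝ) : Fin n → ℝ :=
  fun i => ε ^ S.m * S.taylor α ε Ω u x (S.shift i)

/-- The leading term `𝐅` for `f = k / h`. In
`z_{N+1}^{t+1} - f(…) = (z_{N+1}^{t+1} h(…) - k(…)) / h(…)`
the Taylor expansions are inserted into the numerator, and of the resulting polynomial the
monomials are kept that have only derivatives of order at most `α`. What is kept is the value of the
numerator on the Taylor polynomials; it is divided by `ε^m h(ε^m u(…), …)`. -/
def leading (S : ApproxData n) (k h : MvPolynomial (Fin n) ℝ) (α : ℕ) (ε : ℝ)
    (Ω : Set (ℝ × ℝ)) (u : ℝ × ℝ → ℝ) (x : ℝ × ℝ) : ℝ :=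
  ((ε ^ S.m * S.taylor α ε Ω u x (1, 1)) * MvPolynomial.eval (S.taylorArgs α ε Ω u x) h
      - MvPolynomial.eval (S.taylorArgs α ε Ω u x) k) / ε ^ S.m /
    MvPolynomial.eval (S.args ε u x) h

/-- The error term `𝐅¹`, determined by
`z_{N+1}^{t+1} - f(…) = ε^m 𝐅 + ε^{m+1} 𝐅¹`. -/
def error (S : ApproxData n) (k h : MvPolynomial (Fin n) ℝ) (α : ℕ) (ε : ℝ)
    (Ω : Set (ℝ × ℝ)) (u : ℝ × ℝ → ℝ) (x : ℝ × ℝ) : ℝ :=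
  (ε ^ S.m * u (S.pt ε x (1, 1))
      - MvPolynomial.eval (S.args ε u x) k / MvPolynomial.eval (S.args ε u x) h
      - ε ^ S.m * S.leading k h α ε Ω u x) / ε ^ (S.m + 1)

/-- `P` (of order `α`) belongs to `𝐏𝐃𝐄₂^*` through the dynamics `z_{N+1}^{t+1} = f(…)` with the
approximation data `S`. Here `f = k / h` with polynomials `k` and `h`, there is a positive function
`H` with `𝐅 = P / H`, and the error term is bounded by a constant times the sum of the absolute
values of the derivatives of order `α + 1` at intermediate points `ξ` of the Taylor expansions.
For the kind `fin` the dynamics has to be consistent. -/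
def Approximates (S : ApproxData n) (kind : DomainKind) (f : (Fin n → ℝ) → ℝ) {α : ℕ}
    (P : PDEFamily α) : Prop :=
  (kind = .fin → S.Consistent) ∧
  ∃ k h : MvPolynomial (Fin n) ℝ,
    (∀ z : Fin n → ℝ, (∀ i, 0 < z i) →
      0 < MvPolynomial.eval z h ∧ f z = MvPolynomial.eval z k / MvPolynomial.eval z h) ∧
    ∃ H : ℝ → (Fin n → ℝ) → ℝ,
      (∀ ε z, 0 < ε → ε < 1 → (∀ i, 0 < z i) → 0 < H ε z) ∧
      ∃ C : ℝ, 0 ≤ C ∧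
        ∀ A T : ℝ≥0∞, kind.Allows A → 0 < T →
        ∀ ε : ℝ, 0 < ε → ε < 1 →
        ∀ u : ℝ × ℝ → ℝ, IsPositiveOfClass (α + 1) (domain A T) u →
        ∀ x ∈ domain A T, S.pt ε x (1, 1) ∈ domain A T →
          (∀ i, S.pt ε x (S.shift i) ∈ domain A T) →
          S.leading k h α ε (domain A T) u x
              = P.value ε (domain A T) u x / H ε (S.args ε u x) ∧
          ∃ ξ : ℕ × ℕ → ℝ × ℝ,
            (∀ ab, ξ ab ∈ segment ℝ x (S.pt ε x (1, 1)) ∨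
              ∃ i, ξ ab ∈ segment ℝ x (S.pt ε x (S.shift i))) ∧
            |S.error k h α ε (domain A T) u x| ≤
              C * ∑ ab ∈ Finset.HasAntidiagonal.antidiagonal (α + 1), |pderiv (domain A T) u ab (ξ ab)|

end ApproxData

end RoughPDE

end

/-! In logarithmic coordinates to base `t`, a relatively elementary function equals `t` to the power
of its (max,+)-function up to a factor `M`, since a sum of powers lies between its largest term and
the number of terms times it. Tropically equivalent `f` and `g` share a (max,+)-function, which is
`c`-Lipschitz; so at arguments whose quotients are at most `ρ`, their values differ by a factor at
most `M² ρ^c` (`relElem_le_mul_relElem`).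

A solution of the PDE makes the leading term vanish, and a small derivative rate makes the Taylor
error at most half of the new value. Hence a solution obeys its discrete dynamics up to a factor 2
(`Approximates.exists_bound`). Comparing two solutions therefore costs `4 M² ρ^c` per step, that is
the recursion `B ↦ (2M)² B^c` started at the initial rate (`ratio_le_growthBound`).

The number of steps is measured by a linear `weight` that drops by at least 1 along every dependency
of the dynamics and is at most `k y`, with 1 to spare. Solving the recursion gives double
exponential growth for `c > 1` and exponential growth for `c = 1`. -/

namespace RoughPDE

/-! ### Comparison of sums of powers with their largest term -/

theorem rpow_iSup_le_sum {m : ℕ} (hm : 0 < m) {t : ℝ} (ht : 1 < t) (e : Fin m → ℝ) :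
    t ^ (⨆ i, e i) ≤ ∑ i, t ^ e i := by
  have : Nonempty (Fin m) := ⟨⟨0, hm⟩⟩
  obtain ⟨i, hi⟩ := exists_eq_ciSup_of_finite (f := e)
  rw [← hi]
  exact Finset.single_le_sum (f := fun i => t ^ e i)
    (fun j _ => (Real.rpow_pos_of_pos (by linarith) _).le) (Finset.mem_univ i)

theorem sum_le_mul_rpow_iSup {m : ℕ} {t : ℝ} (ht : 1 < t) (e : Fin m → ℝ) :
    ∑ i, t ^ e i ≤ m * t ^ (⨆ i, e i) := by
  have h : ∀ i ∈ (Finset.univ : Finset (Fin m)), t ^ e i ≤ t ^ (⨆ i, e i) := fun i _ =>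
    Real.rpow_le_rpow_of_exponent_le ht.le (le_ciSup (Set.finite_range e).bddAbove i)
  simpa using Finset.sum_le_card_nsmul _ _ _ h

theorem rpow_mul_prod_zpow {n : ℕ} {t : ℝ} (ht : 1 < t) (α : ℝ) (a : Fin n → ℤ)
    {z : Fin n → ℝ} (hz : ∀ j, 0 < z j) :
    t ^ α * ∏ j, z j ^ a j = t ^ (α + ∑ j, (a j : ℝ) * Real.logb t (z j)) := by
  have ht0 : 0 < t := by linarith
  rw [Real.rpow_add ht0, Real.rpow_sum_of_pos ht0]
  congr 1
  refine Finset.prod_congr rfl fun j _ => ?_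
  rw [mul_comm, Real.rpow_mul ht0.le, Real.rpow_logb ht0 ht.ne' (hz j), Real.rpow_intCast]

/-! ### Lipschitz continuity of `(max, +)`-functions -/

/-- The constant is crude; it only serves to show that some Lipschitz constant exists. -/
theorem abs_iSup_affine_sub_le {m n : ℕ} (hm : 0 < m) (α : Fin m → ℝ) (a : Fin m → Fin n → ℤ)
    (x y : Fin n → ℝ) :
    |(⨆ i, (α i + ∑ j, (a i j : ℝ) * x j)) - ⨆ i, (α i + ∑ j, (a i j : ℝ) * y j)| ≤
      (∑ i, ∑ j, |(a i j : ℝ)|) * ‖x - y‖ := by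
  have : Nonempty (Fin m) := ⟨⟨0, hm⟩⟩
  have key : ∀ x y : Fin n → ℝ, (⨆ i, (α i + ∑ j, (a i j : ℝ) * x j)) ≤
      (⨆ i, (α i + ∑ j, (a i j : ℝ) * y j)) + (∑ i, ∑ j, |(a i j : ℝ)|) * ‖x - y‖ := by
    intro x y
    refine ciSup_le fun i => ?_
    have h1 : α i + ∑ j, (a i j : ℝ) * y j ≤ ⨆ i, (α i + ∑ j, (a i j : ℝ) * y j) :=
      le_ciSup (f := fun i => α i + ∑ j, (a i j : ℝ) * y j) (Set.finite_range _).bddAbove i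
    have h2 : ∑ j, (a i j : ℝ) * x j - ∑ j, (a i j : ℝ) * y j ≤
        (∑ j, |(a i j : ℝ)|) * ‖x - y‖ := by
      rw [← Finset.sum_sub_distrib, Finset.sum_mul]
      refine Finset.sum_le_sum fun j _ => ?_
      rw [← mul_sub]
      refine (le_abs_self _).trans ?_
      rw [abs_mul]
      exact mul_le_mul_of_nonneg_left (norm_le_pi_norm (x - y) j) (abs_nonneg _)
    have h3 : ∑ j, |(a i j : ℝ)| ≤ ∑ i, ∑ j, |(a i j : ℝ)| :=
      Finset.single_le_sum (f := fun i => ∑ j, |(a i j : ℝ)|)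
        (fun i _ => Finset.sum_nonneg fun j _ => abs_nonneg _) (Finset.mem_univ i)
    have h4 := mul_le_mul_of_nonneg_right h3 (norm_nonneg (x - y))
    linarith
  have h1 := key x y
  have h2 := key y x
  rw [norm_sub_rev] at h2
  rw [abs_le]
  constructor <;> linarith

namespace RelMaxPlus

variable {n : ℕ}

theorem abs_trop_sub_le (φ : RelMaxPlus n) (x y : Fin n → ℝ) :
    |φ.trop x - φ.trop y| ≤ φ.lipConst * ‖x - y‖ := by
  -- Nonemptiness matters: `sInf` of the empty set is 0, which would say nothing about Lipschitz
  -- continuity.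
  have hne : {K : ℝ | 0 ≤ K ∧ ∀ x y, |φ.trop x - φ.trop y| ≤ K * ‖x - y‖}.Nonempty := by
    refine ⟨(∑ i, ∑ j, |(φ.numExp i j : ℝ)|) + ∑ i, ∑ j, |(φ.denExp i j : ℝ)|,
      by positivity, fun x y => ?_⟩
    have h1 := abs_iSup_affine_sub_le φ.numTerms_pos φ.numCoeff φ.numExp x y
    have h2 := abs_iSup_affine_sub_le φ.denTerms_pos φ.denCoeff φ.denExp x y
    rw [abs_le] at *
    unfold trop
    constructor <;> linarith
  rcases (norm_nonneg (x - y)).eq_or_lt with h | h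
  · have : x = y := by rw [← sub_eq_zero, ← norm_eq_zero, ← h]
    simp [this]
  -- Every admissible `K` is at least the difference quotient, hence so is the infimum: the best
  -- constant is attained.
  · rw [← div_le_iff₀ h]
    refine le_trans (le_csInf hne ?_) (le_max_right _ _)
    rintro K ⟨-, hK⟩
    rw [div_le_iff₀ h]
    exact hK x y

theorem one_le_lipConst (φ : RelMaxPlus n) : 1 ≤ φ.lipConst := le_max_left _ _

theorem numTerms_le_components (φ : RelMaxPlus n) : φ.numTerms ≤ φ.components :=
  Nat.le_mul_of_pos_right _ φ.denTerms_pos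

theorem denTerms_le_components (φ : RelMaxPlus n) : φ.denTerms ≤ φ.components :=
  Nat.le_mul_of_pos_left _ φ.numTerms_pos

theorem one_le_components (φ : RelMaxPlus n) : 1 ≤ φ.components :=
  Nat.mul_pos φ.numTerms_pos φ.denTerms_pos

theorem relElem_eq (φ : RelMaxPlus n) {t : ℝ} (ht : 1 < t) {z : Fin n → ℝ} (hz : ∀ i, 0 < z i) :
    φ.relElem t z =
      (∑ i, t ^ (φ.numCoeff i + ∑ j, (φ.numExp i j : ℝ) * Real.logb t (z j))) /
        ∑ i, t ^ (φ.denCoeff i + ∑ j, (φ.denExp i j : ℝ) * Real.logb t (z j)) := by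
  simp only [relElem, rpow_mul_prod_zpow ht _ _ hz]

/-- The numerator is at most `numTerms` times its largest power, and the denominator is at least its
own largest power. The reverse estimate loses `denTerms` instead; both are covered by `components`.
-/
theorem relElem_le (φ : RelMaxPlus n) {t : ℝ} (ht : 1 < t) {z : Fin n → ℝ} (hz : ∀ i, 0 < z i) :
    φ.relElem t z ≤ φ.components * t ^ φ.trop (fun j => Real.logb t (z j)) := by
  have ht0 : 0 < t := by linarith
  rw [relElem_eq φ ht hz, trop, Real.rpow_sub ht0, ← mul_div_assoc]
  refine div_le_div₀ (by positivity) ((sum_le_mul_rpow_iSup ht _).trans ?_)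
    (by positivity) (rpow_iSup_le_sum φ.denTerms_pos ht _)
  exact mul_le_mul_of_nonneg_right (by exact_mod_cast φ.numTerms_le_components) (by positivity)

theorem rpow_trop_le (φ : RelMaxPlus n) {t : ℝ} (ht : 1 < t) {z : Fin n → ℝ}
    (hz : ∀ i, 0 < z i) :
    t ^ φ.trop (fun j => Real.logb t (z j)) ≤ φ.components * φ.relElem t z := by
  have ht0 : 0 < t := by linarith
  have hd : (0 : ℝ) < ∑ i, t ^ (φ.denCoeff i + ∑ j, (φ.denExp i j : ℝ) * Real.logb t (z j)) :=
    (Real.rpow_pos_of_pos ht0 _).trans_le (rpow_iSup_le_sum φ.denTerms_pos ht _)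
  rw [relElem_eq φ ht hz, trop, Real.rpow_sub ht0, ← mul_div_assoc, div_le_div_iff₀ (by positivity) hd]
  have h1 := rpow_iSup_le_sum φ.numTerms_pos ht
    (fun i => φ.numCoeff i + ∑ j, (φ.numExp i j : ℝ) * Real.logb t (z j))
  have h2 := sum_le_mul_rpow_iSup ht
    (fun i => φ.denCoeff i + ∑ j, (φ.denExp i j : ℝ) * Real.logb t (z j))
  have h3 : (φ.denTerms : ℝ) ≤ φ.components := by exact_mod_cast φ.denTerms_le_components
  calc _ ≤ _ := mul_le_mul h1 h2 hd.le ((Real.rpow_pos_of_pos ht0 _).le.trans h1)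
    _ ≤ _ := by
        rw [← mul_assoc, mul_comm _ (φ.denTerms : ℝ)]
        gcongr

/-- Tropically equivalent relatively elementary functions at arguments whose quotients are bounded
by `ρ` have quotient at most `M² ρ^c`. -/
theorem relElem_le_mul_relElem {φ ψ : RelMaxPlus n} {t : ℝ} (ht : 1 < t) (h : φ.TropEquiv ψ)
    {M c ρ : ℝ} (hφM : φ.components ≤ M) (hψM : ψ.components ≤ M) (hc : φ.lipConst ≤ c)
    (hρ : 1 ≤ ρ) {z w : Fin n → ℝ} (hz : ∀ i, 0 < z i) (hw : ∀ i, 0 < w i)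
    (hzw : ∀ i, z i ≤ ρ * w i) (hwz : ∀ i, w i ≤ ρ * z i) :
    φ.relElem t z ≤ M ^ 2 * ρ ^ c * ψ.relElem t w := by
  have ht0 : 0 < t := by linarith
  have hρ0 : 0 < ρ := by linarith
  have hM : 0 ≤ M := (Nat.cast_nonneg _).trans hφM
  have hlog : 0 ≤ Real.logb t ρ := Real.logb_nonneg ht hρ
  -- Quotients bounded by `ρ` become distance at most `logb t ρ` in the maximum norm.
  have hnorm : ‖(fun j => Real.logb t (z j)) - fun j => Real.logb t (w j)‖ ≤ Real.logb t ρ := by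
    rw [pi_norm_le_iff_of_nonneg hlog]
    intro i
    have h1 : Real.logb t (z i) ≤ Real.logb t ρ + Real.logb t (w i) := by
      rw [← Real.logb_mul hρ0.ne' (hw i).ne']
      exact Real.logb_le_logb_of_le ht (hz i) (hzw i)
    have h2 : Real.logb t (w i) ≤ Real.logb t ρ + Real.logb t (z i) := by
      rw [← Real.logb_mul hρ0.ne' (hz i).ne']
      exact Real.logb_le_logb_of_le ht (hw i) (hwz i)
    rw [Pi.sub_apply, Real.norm_eq_abs, abs_le]
    constructor <;> linarith
  have hc0 : 0 ≤ c := by linarith [φ.one_le_lipConst]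
  -- Tropical equivalence replaces `φ.trop` by `ψ.trop` at `w`; the Lipschitz term becomes the
  -- factor `ρ ^ c` after exponentiation.
  have htrop : φ.trop (fun j => Real.logb t (z j)) ≤
      Real.logb t ρ * c + ψ.trop (fun j => Real.logb t (w j)) := by
    have h1 := (le_abs_self _).trans
      (φ.abs_trop_sub_le (fun j => Real.logb t (z j)) (fun j => Real.logb t (w j)))
    have h2 := mul_le_mul hc hnorm (norm_nonneg _) hc0
    rw [← show φ.trop = ψ.trop from h]
    linarith
  have hpow : t ^ φ.trop (fun j => Real.logb t (z j)) ≤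
      ρ ^ c * t ^ ψ.trop (fun j => Real.logb t (w j)) := by
    calc _ ≤ _ := Real.rpow_le_rpow_of_exponent_le ht.le htrop
      _ = _ := by rw [Real.rpow_add ht0, Real.rpow_mul ht0.le, Real.rpow_logb ht0 ht.ne' hρ0]
  have hψ0 : 0 ≤ ψ.relElem t w := by
    rw [relElem_eq ψ ht hw]
    positivity
  calc φ.relElem t z ≤ φ.components * t ^ φ.trop (fun j => Real.logb t (z j)) := φ.relElem_le ht hz
    _ ≤ M * (ρ ^ c * (M * ψ.relElem t w)) := by
        refine mul_le_mul hφM (hpow.trans ?_) (by positivity) hM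
        refine mul_le_mul_of_nonneg_left ((ψ.rpow_trop_le ht hw).trans ?_) (by positivity)
        exact mul_le_mul_of_nonneg_right hψM hψ0
    _ = _ := by ring

end RelMaxPlus

/-! ### Solutions almost satisfy the discrete dynamics -/

/-- Keeps the intermediate points of the Taylor expansions inside the domain, where the derivative
rate controls them. -/
theorem convex_domain (A T : ℝ≥0∞) : Convex ℝ (domain A T) := by
  have aux : ∀ B : ℝ≥0∞, Convex ℝ {x : ℝ | ENNReal.ofReal x < B} := fun B =>
    Set.OrdConnected.convex ⟨fun x _ y hy z hz =>
      (ENNReal.ofReal_le_ofReal hz.2).trans_lt (show ENNReal.ofReal y < B from hy)⟩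
  have h1 : Convex ℝ (Set.Ioi (0 : ℝ) ∩ {x : ℝ | ENNReal.ofReal x < A}) :=
    (convex_Ioi 0).inter (aux A)
  have h2 : Convex ℝ (Set.Ici (0 : ℝ) ∩ {x : ℝ | ENNReal.ofReal x < T}) :=
    (convex_Ici 0).inter (aux T)
  have h := h1.prod h2
  convert h using 1
  ext p
  simp [domain, and_assoc]

theorem ofReal_pderiv_le {r : ℕ} {Ω : Set (ℝ × ℝ)} {u : ℝ × ℝ → ℝ}
    (hK : derivRate r Ω u ≠ ⊤) {ab : ℕ × ℕ}
    (hab : ab ∈ Finset.HasAntidiagonal.antidiagonal r) {p p' : ℝ × ℝ} (hp : p ∈ Ω) (hp' : p' ∈ Ω) :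
    ENNReal.ofReal |pderiv Ω u ab p| ≤ derivRate r Ω u * ENNReal.ofReal (u p') := by
  have h1 : ENNReal.ofReal |pderiv Ω u ab p| ≤ derivNorm r Ω u :=
    le_iSup₂_of_le ab hab (le_iSup₂_of_le p hp le_rfl)
  have h2 : (⨅ p ∈ Ω, ENNReal.ofReal (u p)) ≤ ENNReal.ofReal (u p') := iInf₂_le p' hp'
  refine h1.trans (le_trans ?_ (mul_le_mul_right h2 _))
  -- If the infimum is 0, a finite rate forces all derivatives of this order to vanish.
  rcases eq_or_ne (⨅ p ∈ Ω, ENNReal.ofReal (u p)) 0 with h0 | h0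
  · rcases eq_or_ne (derivNorm r Ω u) 0 with h3 | h3
    · simp [h3]
    · exact absurd (by rw [derivRate, h0, ENNReal.div_zero h3]) hK
  · rw [derivRate, ENNReal.div_mul_cancel h0 (h2.trans_lt ENNReal.ofReal_lt_top).ne]

namespace ApproxData

variable {n : ℕ}

/-- Both `z_{N+1}^{t+1} / f` and its inverse are at most `2` for solutions with small derivative
rate, where the threshold depends only on the approximation. -/
theorem Approximates.exists_bound {S : ApproxData n} {kind : DomainKind}
    {f : (Fin n → ℝ) → ℝ} {α : ℕ} {P : PDEFamily α} (hP : S.Approximates kind f P) :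
    ∃ C : ℝ, 0 < C ∧ ∀ A T : ℝ≥0∞, kind.Allows A → 0 < T → ∀ ε : ℝ, 0 < ε → ε < 1 →
      ∀ u : ℝ × ℝ → ℝ, IsPositiveSolution P ε (domain A T) u →
      ENNReal.ofReal ε * (ENNReal.ofReal C * derivRate (α + 1) (domain A T) u) ≤ 1 →
      ∀ x ∈ domain A T, S.pt ε x (1, 1) ∈ domain A T →
        (∀ i, S.pt ε x (S.shift i) ∈ domain A T) →
        f (S.args ε u x) ≤ 2 * (ε ^ S.m * u (S.pt ε x (1, 1))) ∧
          ε ^ S.m * u (S.pt ε x (1, 1)) ≤ 2 * f (S.args ε u x) := by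
  obtain ⟨-, k, h, hkh, H, -, C, hC, hmain⟩ := hP
  -- There are `α + 2` derivatives of order `α + 1`; `C + 1` bounds the error constant and is
  -- positive; the 2 makes the error at most half of the new value.
  refine ⟨2 * (C + 1) * (α + 2), by positivity, ?_⟩
  intro A T hA hT ε hε hε1 u hu hK x hx hx1 hxs
  set Ω := domain A T
  obtain ⟨hlead, ξ, hξ, herr⟩ := hmain A T hA hT ε hε hε1 u hu.1 x hx hx1 hxs
  have hpos : ∀ i, 0 < S.args ε u x i := fun i =>
    mul_pos (zpow_pos hε _) (hu.1.2 _ (hxs i))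
  obtain ⟨-, hf⟩ := hkh _ hpos
  -- For a solution the leading term is `0 / H = 0`, so the whole defect is the error term.
  rw [hu.2 x hx, zero_div] at hlead
  have hC0 : 0 < 2 * (C + 1) * (α + 2 : ℝ) := by positivity
  have hKtop : derivRate (α + 1) Ω u ≠ ⊤ := by
    intro htop
    rw [htop, ENNReal.mul_top (by simpa using hC0), ENNReal.mul_top (by simpa using hε)] at hK
    exact absurd hK (by simp)
  obtain ⟨κ, hκ0, hκ⟩ : ∃ κ : ℝ, 0 ≤ κ ∧ derivRate (α + 1) Ω u = ENNReal.ofReal κ :=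
    ⟨_, ENNReal.toReal_nonneg, (ENNReal.ofReal_toReal hKtop).symm⟩
  rw [hκ, ← ENNReal.ofReal_mul hC0.le, ← ENNReal.ofReal_mul hε.le, ENNReal.ofReal_le_one] at hK
  set y := S.pt ε x (1, 1)
  have hu1 : 0 < u y := hu.1.2 _ hx1
  have hξΩ : ∀ ab, ξ ab ∈ Ω := by
    intro ab
    rcases hξ ab with h | ⟨i, h⟩
    · exact (convex_domain A T).segment_subset hx hx1 h
    · exact (convex_domain A T).segment_subset hx (hxs i) h
  have hsum : ∑ ab ∈ Finset.HasAntidiagonal.antidiagonal (α + 1), |pderiv Ω u ab (ξ ab)| ≤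
      (α + 2) * (κ * u y) := by
    have h1 : ∀ ab ∈ Finset.HasAntidiagonal.antidiagonal (α + 1),
        |pderiv Ω u ab (ξ ab)| ≤ κ * u y := by
      intro ab hab
      have h2 := ofReal_pderiv_le hKtop hab (hξΩ ab) hx1
      rw [hκ, ← ENNReal.ofReal_mul hκ0] at h2
      exact (ENNReal.ofReal_le_ofReal_iff (by positivity)).1 h2
    have h3 := Finset.sum_le_card_nsmul _ _ _ h1
    rw [Finset.Nat.card_antidiagonal, nsmul_eq_mul] at h3
    push_cast at h3
    linarith
  have hE : S.error k h α ε Ω u x * ε ^ (S.m + 1) = ε ^ S.m * u y - f (S.args ε u x) := by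
    rw [error, hlead, hf, div_mul_cancel₀ _ (zpow_pos hε _).ne']
    ring
  -- A defect of at most half the new value gives both factor 2 estimates.
  have hbound : |ε ^ S.m * u y - f (S.args ε u x)| ≤ ε ^ S.m * u y / 2 := by
    have hεm : 0 < ε ^ S.m := zpow_pos hε _
    rw [← hE, abs_mul, abs_of_pos (zpow_pos hε _), zpow_add_one₀ hε.ne']
    have h1 : |S.error k h α ε Ω u x| ≤ (C + 1) * ((α + 2) * (κ * u y)) :=
      herr.trans (mul_le_mul (by linarith) hsum
        (Finset.sum_nonneg fun _ _ => abs_nonneg _) (by linarith))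
    calc _ ≤ (C + 1) * ((α + 2) * (κ * u y)) * (ε ^ S.m * ε) :=
          mul_le_mul_of_nonneg_right h1 (by positivity)
      _ = (ε * (2 * (C + 1) * (α + 2) * κ)) * (ε ^ S.m * u y / 2) := by ring
      _ ≤ 1 * (ε ^ S.m * u y / 2) := mul_le_mul_of_nonneg_right hK (by positivity)
      _ = _ := one_mul _
  rw [abs_le] at hbound
  constructor <;> linarith

/-! ### The causal order of the dynamics -/

theorem neg_l_le (S : ApproxData n) (i : Fin n) : -(S.l : ℤ) ≤ (S.shift i).1 := by
  have h : (-(S.shift i).1).toNat ≤ S.l :=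
    Finset.le_sup (f := fun i => (-(S.shift i).1).toNat) (Finset.mem_univ i)
  omega

theorem neg_d_le (S : ApproxData n) (i : Fin n) : -(S.d : ℤ) ≤ (S.shift i).2 := by
  have h : (-(S.shift i).2).toNat ≤ S.d :=
    Finset.le_sup (f := fun i => (-(S.shift i).2).toNat) (Finset.mem_univ i)
  omega

theorem shift_fst_le_k (S : ApproxData n) (i : Fin n) : (S.shift i).1 ≤ S.k := by
  have h : (S.shift i).1.toNat ≤ S.k :=
    (Finset.le_sup (f := fun i => (S.shift i).1.toNat) (Finset.mem_univ i)).trans (le_max_right _ _)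
  omega

theorem one_le_k (S : ApproxData n) : 1 ≤ S.k := le_max_left _ _

theorem neg_L_le_fst (S : ApproxData n) (i : Fin n) : -(S.L : ℝ) ≤ (S.shift i).1 := by
  have h := S.neg_l_le i
  have h' : S.l ≤ S.L := le_max_left _ _
  have : -(S.L : ℤ) ≤ (S.shift i).1 := by omega
  exact_mod_cast this

theorem neg_L_le_snd (S : ApproxData n) (i : Fin n) : -(S.L : ℝ) ≤ (S.shift i).2 := by
  have h := S.neg_d_le i
  have h' : S.d ≤ S.L := le_max_right _ _
  have : -(S.L : ℤ) ≤ (S.shift i).2 := by omega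
  exact_mod_cast this

theorem shift_snd_le_one (S : ApproxData n) (i : Fin n) : (S.shift i).2 ≤ 1 := by
  rcases S.shift_mem i with h | h <;> omega

/-- A linear function that drops by at least `1` from `(N + 1, t + 1)` to the variables
of the dynamics. -/
noncomputable def weight (S : ApproxData n) (ε : ℝ) (p : ℝ × ℝ) : ℝ := p.1 / ε ^ S.p + S.k * (p.2 / ε ^ S.q)

theorem weight_pt (S : ApproxData n) {ε : ℝ} (hε : 0 < ε) (x : ℝ × ℝ) (σ : ℤ × ℤ) :
    S.weight ε (S.pt ε x σ) = S.weight ε x + σ.1 + S.k * σ.2 := by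
  have hp : ε ^ S.p ≠ 0 := (pow_pos hε _).ne'
  have hq : ε ^ S.q ≠ 0 := (pow_pos hε _).ne'
  simp only [weight, pt]
  field_simp
  ring

/-- The target has increment `1 + k`. A variable in the new row has `a ≤ 0` and increment at most
`k`; one in an older row has `a ≤ k` and `k b ≤ 0`. The slope `k` in time is chosen to cover both.
-/
theorem weight_shift_add_one_le (S : ApproxData n) {ε : ℝ} (hε : 0 < ε) (x : ℝ × ℝ) (i : Fin n) :
    S.weight ε (S.pt ε x (S.shift i)) + 1 ≤ S.weight ε (S.pt ε x (1, 1)) := by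
  rw [weight_pt S hε, weight_pt S hε]
  have hk : (0 : ℤ) ≤ S.k := Int.natCast_nonneg _
  have h : (S.shift i).1 + S.k * (S.shift i).2 ≤ S.k := by
    rcases S.shift_mem i with ⟨h1, h2⟩ | h
    · rw [h1]
      linarith
    · have h1 := S.shift_fst_le_k i
      have h2 : (S.k : ℤ) * (S.shift i).2 ≤ 0 := mul_nonpos_of_nonneg_of_nonpos hk h
      linarith
  have h' : ((S.shift i).1 : ℝ) + S.k * (S.shift i).2 ≤ S.k := by exact_mod_cast h
  push_cast
  linarith

/-- The `+ 1` on the left pays for rounding the weight up to an integer; it is absorbed by the `+ 1`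
in `y`. -/
theorem weight_add_one_le (S : ApproxData n) {ε : ℝ} (hε : 0 < ε) (hε1 : ε ≤ 1) {p : ℝ × ℝ}
    (h1 : 0 ≤ p.1) (h2 : 0 ≤ p.2) :
    S.weight ε p + 1 ≤ S.k * (ε ^ (-(S.D : ℝ)) * (p.1 + p.2 + 1)) := by
  have hk : (1 : ℝ) ≤ S.k := by exact_mod_cast S.one_le_k
  rw [Real.rpow_neg hε.le, Real.rpow_natCast, weight]
  have hD : 0 < ε ^ S.D := pow_pos hε _
  have hp : (ε ^ S.p)⁻¹ ≤ (ε ^ S.D)⁻¹ :=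
    inv_anti₀ hD (pow_le_pow_of_le_one hε.le hε1 (le_max_left _ _))
  have hq : (ε ^ S.q)⁻¹ ≤ (ε ^ S.D)⁻¹ :=
    inv_anti₀ hD (pow_le_pow_of_le_one hε.le hε1 (le_max_right _ _))
  have hone : 1 ≤ (ε ^ S.D)⁻¹ := (one_le_inv₀ hD).2 (pow_le_one₀ hε.le hε1)
  have e1 : p.1 / ε ^ S.p ≤ S.k * ((ε ^ S.D)⁻¹ * p.1) := by
    rw [div_eq_inv_mul]
    exact (mul_le_mul_of_nonneg_right hp h1).trans (le_mul_of_one_le_left (by positivity) hk)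
  have e2 : (S.k : ℝ) * (p.2 / ε ^ S.q) ≤ S.k * ((ε ^ S.D)⁻¹ * p.2) := by
    rw [div_eq_inv_mul]
    gcongr
  have e3 : (1 : ℝ) ≤ S.k * (ε ^ S.D)⁻¹ := one_le_mul_of_one_le_of_one_le hk hone
  calc _ ≤ S.k * ((ε ^ S.D)⁻¹ * p.1) + S.k * ((ε ^ S.D)⁻¹ * p.2) + S.k * (ε ^ S.D)⁻¹ :=
        add_le_add (add_le_add e1 e2) e3
    _ = _ := by ring

/-- Every point outside of the initial region is of the form `(N + 1, t + 1)`, with all variables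
of the dynamics in the domain. -/
theorem exists_base_point (S : ApproxData n) {kind : DomainKind}
    (hS : kind = .fin → S.Consistent) {A T : ℝ≥0∞} (hA : kind.Allows A) {ε : ℝ} (hε : 0 < ε)
    (hε1 : ε ≤ 1) {p : ℝ × ℝ} (hp : p ∈ domain A T) (h1 : ((S.L : ℝ) + 1) * ε < p.1)
    (h2 : ((S.L : ℝ) + 1) * ε < p.2) :
    ∃ x ∈ domain A T, S.pt ε x (1, 1) = p ∧ ∀ i, S.pt ε x (S.shift i) ∈ domain A T := by
  have hpε : ε ^ S.p ≤ ε := pow_le_of_le_one hε.le hε1 (Nat.one_le_iff_ne_zero.1 S.one_le_p)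
  have hqε : ε ^ S.q ≤ ε := pow_le_of_le_one hε.le hε1 (Nat.one_le_iff_ne_zero.1 S.one_le_q)
  have hp0 : 0 < ε ^ S.p := pow_pos hε _
  have hq0 : 0 < ε ^ S.q := pow_pos hε _
  have hL : (0 : ℝ) ≤ S.L := Nat.cast_nonneg _
  -- One step back to the base point and at most `L` further back to a variable: `L + 1` steps, each
  -- no longer than `ε`.
  have e1 : ((S.L : ℝ) + 1) * ε ^ S.p ≤ (S.L + 1) * ε :=
    mul_le_mul_of_nonneg_left hpε (by linarith)
  have e2 : ((S.L : ℝ) + 1) * ε ^ S.q ≤ (S.L + 1) * ε :=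
    mul_le_mul_of_nonneg_left hqε (by linarith)
  have e3 : 0 ≤ (S.L : ℝ) * ε ^ S.p := by positivity
  have e4 : 0 ≤ (S.L : ℝ) * ε ^ S.q := by positivity
  refine ⟨(p.1 - ε ^ S.p, p.2 - ε ^ S.q), ⟨?_, ?_, ?_, ?_⟩, ?_, fun i => ⟨?_, ?_, ?_, ?_⟩⟩
  · dsimp only
    linarith
  · exact (ENNReal.ofReal_le_ofReal (by dsimp only; linarith)).trans_lt hp.2.1
  · dsimp only
    linarith
  · exact (ENNReal.ofReal_le_ofReal (by dsimp only; linarith)).trans_lt hp.2.2.2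
  · simp [pt]
  · have := mul_le_mul_of_nonneg_right (S.neg_L_le_fst i) hp0.le
    simp only [pt]
    linarith
  -- The right end of the domain is the only place where the kind matters: either there is no end,
  -- or consistency keeps the variables no further right than `p`.
  · cases kind with
    | infty =>
      rw [show A = ⊤ from hA]
      exact ENNReal.ofReal_lt_top
    | fin =>
      have h : ((S.shift i).1 : ℝ) ≤ 1 := by exact_mod_cast hS rfl i
      have := mul_le_mul_of_nonneg_right h hp0.le
      exact (ENNReal.ofReal_le_ofReal (by simp only [pt]; linarith)).trans_lt hp.2.1
  · have := mul_le_mul_of_nonneg_right (S.neg_L_le_snd i) hq0.le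
    simp only [pt]
    linarith
  · have h : ((S.shift i).2 : ℝ) ≤ 1 := by exact_mod_cast S.shift_snd_le_one i
    have := mul_le_mul_of_nonneg_right h hq0.le
    exact (ENNReal.ofReal_le_ofReal (by simp only [pt]; linarith)).trans_lt hp.2.2.2

end ApproxData

/-! ### The growth of the bound along the dynamics -/

/-- The solution of `B_{j+1} = K B_j^c` with `B_0 = r`. -/
noncomputable def growthBound (K c r : ℝ) (j : ℕ) : ℝ := K ^ (∑ i ∈ Finset.range j, c ^ i) * r ^ (c ^ j)

theorem growthBound_succ {K c r : ℝ} (hK : 1 ≤ K) (hr : 1 ≤ r) (j : ℕ) :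
    growthBound K c r (j + 1) = K * growthBound K c r j ^ c := by
  have hK0 : 0 < K := by linarith
  have hr0 : 0 ≤ r := by linarith
  rw [growthBound, growthBound, Real.mul_rpow (by positivity) (by positivity),
    ← Real.rpow_mul hK0.le, ← Real.rpow_mul hr0, geom_sum_succ, add_comm, Real.rpow_add hK0,
    Real.rpow_one, pow_succ, mul_comm c]
  ring

theorem le_growthBound {K c r : ℝ} (hK : 1 ≤ K) (hc : 1 ≤ c) (hr : 1 ≤ r) (j : ℕ) :
    r ≤ growthBound K c r j := by
  have hr0 : 0 ≤ r := by linarith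
  have h1 : 1 ≤ K ^ (∑ i ∈ Finset.range j, c ^ i) :=
    Real.one_le_rpow hK (Finset.sum_nonneg fun _ _ => by positivity)
  have h2 : r ^ (1 : ℝ) ≤ r ^ (c ^ j) := Real.rpow_le_rpow_of_exponent_le hr (one_le_pow₀ hc)
  rw [Real.rpow_one] at h2
  exact h2.trans (le_mul_of_one_le_left (by positivity) h1)

/-! ### Comparison of two solutions by induction on the weight. -/

theorem ratio_le_ofReal_iff {u v : ℝ × ℝ → ℝ} {p : ℝ × ℝ} {B : ℝ} (hB : 0 ≤ B)
    (hu : 0 < u p) (hv : 0 < v p) :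
    ratio u v p ≤ ENNReal.ofReal B ↔ u p ≤ B * v p ∧ v p ≤ B * u p := by
  rw [ratio, max_le_iff, ENNReal.ofReal_le_ofReal_iff hB, ENNReal.ofReal_le_ofReal_iff hB,
    div_le_iff₀ hv, div_le_iff₀ hu]

theorem one_le_ratio {u v : ℝ × ℝ → ℝ} {p : ℝ × ℝ} (hu : 0 < u p) (hv : 0 < v p) :
    1 ≤ ratio u v p := by
  rcases le_total (v p) (u p) with h | h
  · exact le_max_of_le_left (ENNReal.one_le_ofReal.2 ((one_le_div hv).2 h))
  · exact le_max_of_le_right (ENNReal.one_le_ofReal.2 ((one_le_div hu).2 h))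

/-- The discrete comparison principle: the quotient of two solutions is bounded by
`growthBound`, uniformly on points of bounded weight. -/
theorem ratio_le_growthBound {n α : ℕ} {kind : DomainKind} {φ ψ : RelMaxPlus n} {t : ℝ}
    (ht : 1 < t) (hφψ : φ.TropEquiv ψ) {S : ApproxData n} {P Q : PDEFamily α}
    (hP : S.Approximates kind (φ.relElem t) P) (hQ : S.Approximates kind (ψ.relElem t) Q)
    {M c : ℝ} (hφM : φ.components ≤ M) (hψM : ψ.components ≤ M)
    (hφc : φ.lipConst ≤ c) (hψc : ψ.lipConst ≤ c) :
    ∃ C : ℝ, 0 < C ∧ ∀ A T : ℝ≥0∞, kind.Allows A → 0 < T → ∀ ε : ℝ, 0 < ε → ε < 1 →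
      ∀ u v : ℝ × ℝ → ℝ, IsPositiveSolution P ε (domain A T) u →
      IsPositiveSolution Q ε (domain A T) v →
      ENNReal.ofReal ε * (ENNReal.ofReal C *
        max (derivRate (α + 1) (domain A T) u) (derivRate (α + 1) (domain A T) v)) ≤ 1 →
      ∀ r : ℝ, 1 ≤ r → initialRate A T u v (((S.L : ℝ) + 1) * ε) = ENNReal.ofReal r →
      ∀ (j : ℕ), ∀ p ∈ domain A T, S.weight ε p ≤ j →
        ratio u v p ≤ ENNReal.ofReal (growthBound ((2 * M) ^ 2) c r j) := by
  obtain ⟨C₁, hC₁, h₁⟩ := hP.exists_bound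
  obtain ⟨C₂, hC₂, h₂⟩ := hQ.exists_bound
  refine ⟨max C₁ C₂, lt_max_of_lt_left hC₁, ?_⟩
  intro A T hA hT ε hε hε1 u v hu hv hK r hr hR j
  have hM : 1 ≤ M := le_trans (by exact_mod_cast φ.one_le_components) hφM
  have hc : 1 ≤ c := φ.one_le_lipConst.trans hφc
  have hK1 : (1 : ℝ) ≤ (2 * M) ^ 2 := one_le_pow₀ (by linarith)
  have hKu : ENNReal.ofReal ε * (ENNReal.ofReal C₁ * derivRate (α + 1) (domain A T) u) ≤ 1 :=
    le_trans (by gcongr; exacts [le_max_left _ _, le_max_left _ _]) hK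
  have hKv : ENNReal.ofReal ε * (ENNReal.ofReal C₂ * derivRate (α + 1) (domain A T) v) ≤ 1 :=
    le_trans (by gcongr; exacts [le_max_right _ _, le_max_right _ _]) hK
  -- Since `j` is only an upper bound for the weight, plain induction reaches all variables, however
  -- far back they lie.
  induction j with
  | zero =>
    -- Vacuous: `x > 0` makes the weight positive.
    intro p hp hw
    have h1 : 0 < p.1 / ε ^ S.p := div_pos hp.1 (pow_pos hε _)
    have h2 : 0 ≤ S.k * (p.2 / ε ^ S.q) :=
      mul_nonneg (Nat.cast_nonneg _) (div_nonneg hp.2.2.1 (pow_pos hε _).le)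
    rw [ApproxData.weight, Nat.cast_zero] at hw
    linarith
  | succ j ih =>
    intro p hp hw
    by_cases hinit : p.2 ≤ ((S.L : ℝ) + 1) * ε ∨ p.1 ≤ ((S.L : ℝ) + 1) * ε
    · have : ratio u v p ≤ initialRate A T u v (((S.L : ℝ) + 1) * ε) :=
        le_iSup₂_of_le p ⟨hp, hinit⟩ le_rfl
      rw [hR] at this
      exact this.trans (ENNReal.ofReal_le_ofReal (le_growthBound hK1 hc hr _))
    push Not at hinit
    obtain ⟨x, hx, rfl, hxs⟩ :=
      S.exists_base_point hP.1 hA hε hε1.le hp hinit.2 hinit.1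
    set ρ := growthBound ((2 * M) ^ 2) c r j with hρ
    have hρ1 : 1 ≤ ρ := hr.trans (le_growthBound hK1 hc hr j)
    have hεm : 0 < ε ^ S.m := zpow_pos hε _
    have hcmp : ∀ i, u (S.pt ε x (S.shift i)) ≤ ρ * v (S.pt ε x (S.shift i)) ∧
        v (S.pt ε x (S.shift i)) ≤ ρ * u (S.pt ε x (S.shift i)) := by
      intro i
      refine (ratio_le_ofReal_iff (by linarith) (hu.1.2 _ (hxs i)) (hv.1.2 _ (hxs i))).1
        (ih _ (hxs i) ?_)
      have := S.weight_shift_add_one_le hε x i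
      push_cast at hw
      linarith
    have hup : ∀ i, 0 < S.args ε u x i := fun i => mul_pos hεm (hu.1.2 _ (hxs i))
    have hvp : ∀ i, 0 < S.args ε v x i := fun i => mul_pos hεm (hv.1.2 _ (hxs i))
    have huv : ∀ i, S.args ε u x i ≤ ρ * S.args ε v x i := fun i => by
      have := mul_le_mul_of_nonneg_left (hcmp i).1 hεm.le
      simp only [ApproxData.args]
      linarith
    have hvu : ∀ i, S.args ε v x i ≤ ρ * S.args ε u x i := fun i => by
      have := mul_le_mul_of_nonneg_left (hcmp i).2 hεm.le
      simp only [ApproxData.args]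
      linarith
    have hfg := RelMaxPlus.relElem_le_mul_relElem ht hφψ hφM hψM hφc hρ1 hup hvp huv hvu
    have hgf := RelMaxPlus.relElem_le_mul_relElem ht (Eq.symm hφψ) hψM hφM hψc hρ1 hvp hup hvu huv
    obtain ⟨a1, a2⟩ := h₁ A T hA hT ε hε hε1 u hu hKu x hx hp hxs
    obtain ⟨b1, b2⟩ := h₂ A T hA hT ε hε hε1 v hv hKv x hx hp hxs
    have hpow : 0 ≤ M ^ 2 * ρ ^ c := by positivity
    -- One factor 2 for each of the two solutions, times `M²` from comparing `f` with `g`, is the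
    -- constant `(2M)²`.
    rw [growthBound_succ hK1 hr, ← hρ,
      ratio_le_ofReal_iff (by positivity) (hu.1.2 _ hp) (hv.1.2 _ hp)]
    have c1 := mul_le_mul_of_nonneg_left b1 hpow
    have c2 := mul_le_mul_of_nonneg_left a1 hpow
    constructor
    · refine le_of_mul_le_mul_left ?_ hεm
      linarith
    · refine le_of_mul_le_mul_left ?_ hεm
      linarith

/-! ### From the discrete bound to the analytic relation. -/

theorem bound_eq_top {M c : ℝ} (hM : 0 < M) (hc : 0 < c) (g : GrowthKind) (y : ℝ) :
    g.bound M c ⊤ y = ⊤ := by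
  cases g with
  | e =>
    simp only [GrowthKind.bound]
    exact ENNReal.mul_top (by simpa using Real.rpow_pos_of_pos hM _)
  | ee =>
    simp only [GrowthKind.bound]
    rw [ENNReal.top_rpow_of_pos (Real.rpow_pos_of_pos hc _)]
    exact ENNReal.mul_top (by simpa using Real.rpow_pos_of_pos hM _)

/-- A growth type that dominates `growthBound` at `j ≤ k y` relates the two equations. -/
theorem relatedIn_of_growthBound_le {n α : ℕ} {kind : DomainKind} {φ ψ : RelMaxPlus n} {t : ℝ}
    (ht : 1 < t) (hφψ : φ.TropEquiv ψ) {S : ApproxData n} {P Q : PDEFamily α}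
    (hP : S.Approximates kind (φ.relElem t) P) (hQ : S.Approximates kind (ψ.relElem t) Q)
    {M c : ℝ} (hφM : φ.components ≤ M) (hψM : ψ.components ≤ M)
    (hφc : φ.lipConst ≤ c) (hψc : ψ.lipConst ≤ c)
    {growth : GrowthKind} {M' c' : ℝ} (hM' : 1 ≤ M') (hc' : 1 ≤ c') (hgc : growth = .e → c' = 1)
    (hbound : ∀ (r : ℝ) (j : ℕ) (y : ℝ), 1 ≤ r → 0 ≤ y → (j : ℝ) ≤ S.k * y →
      ENNReal.ofReal (growthBound ((2 * M) ^ 2) c r j) ≤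
        growth.bound M' c' (ENNReal.ofReal r) y) :
    RelatedIn kind growth M' c' (S.D : ℝ) ((S.L : ℝ) + 1) P Q := by
  obtain ⟨C, hC, h⟩ := ratio_le_growthBound ht hφψ hP hQ hφM hψM hφc hψc
  have hL : (0 : ℝ) ≤ S.L := Nat.cast_nonneg _
  -- The choice `C' = 1/2` forces `ε < 1`, because `L + 1 ≥ 1`.
  refine ⟨hM', hc', by exact_mod_cast S.one_le_p.trans (le_max_left _ _), by linarith, hgc,
    C, 1 / 2, hC, by norm_num, ?_⟩
  intro A T hA hT ε hε u v hu hv hmin p hp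
  rw [le_min_iff, le_min_iff, le_min_iff] at hmin
  obtain ⟨hK, -, -, hhalf⟩ := hmin
  rw [ENNReal.ofReal_le_ofReal_iff (by norm_num)] at hhalf
  have hεL : ε ≤ ((S.L : ℝ) + 1) * ε := le_mul_of_one_le_left hε.le (by linarith)
  have hε1 : ε < 1 := by linarith
  have hK' : ENNReal.ofReal ε * (ENNReal.ofReal C *
      max (derivRate (α + 1) (domain A T) u) (derivRate (α + 1) (domain A T) v)) ≤ 1 :=
    (mul_le_mul_left ((ENNReal.ofReal_le_ofReal hεL).trans hK) _).trans (by rw [one_div]; exact ENNReal.inv_mul_le_one _)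
  rcases eq_or_ne (initialRate A T u v (((S.L : ℝ) + 1) * ε)) ⊤ with htop | htop
  · rw [htop, bound_eq_top (by linarith) (by linarith)]
    exact le_top
  obtain ⟨r, hr0, hr⟩ : ∃ r : ℝ, 0 ≤ r ∧
      initialRate A T u v (((S.L : ℝ) + 1) * ε) = ENNReal.ofReal r :=
    ⟨_, ENNReal.toReal_nonneg, (ENNReal.ofReal_toReal htop).symm⟩
  -- The point `(x, 0)` lies in the initial region, and the two-sided quotient is at least 1 at
  -- every point.
  have hr1 : 1 ≤ r := by
    have hbase : (p.1, (0 : ℝ)) ∈ domain A T := ⟨hp.1, hp.2.1, le_rfl, by simpa using hT⟩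
    rw [← ENNReal.one_le_ofReal, ← hr]
    refine (one_le_ratio (hu.1.2 _ hbase) (hv.1.2 _ hbase)).trans ?_
    exact le_iSup₂_of_le (f := fun q (_ : q ∈ {p ∈ domain A T | p.2 ≤ ((S.L : ℝ) + 1) * ε ∨
      p.1 ≤ ((S.L : ℝ) + 1) * ε}) => ratio u v q) (p.1, (0 : ℝ))
      ⟨hbase, Or.inl (by dsimp only; positivity)⟩ le_rfl
  rw [hr]
  have hw := S.weight_add_one_le hε hε1.le hp.1.le hp.2.2.1
  have hw0 : 0 ≤ S.weight ε p := by
    have h1 := hp.1.le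
    have h2 := hp.2.2.1
    unfold ApproxData.weight
    positivity
  refine (h A T hA hT ε hε hε1 u v hu hv hK' r hr1 hr ⌈S.weight ε p⌉₊ p hp
    (Nat.le_ceil _)).trans (hbound r _ _ hr1 ?_ ?_)
  · have h1 := hp.1.le
    have h2 := hp.2.2.1
    positivity
  · exact (Nat.ceil_lt_add_one hw0).le.trans hw

end RoughPDE

/-! ### The two growth regimes. -/

theorem corollary3p2 {n α : ℕ} (kind : RoughPDE.DomainKind)
    -- the relatively elementary functions `f = f_t` and `g = g_t`
    (φ ψ : RoughPDE.RelMaxPlus n) (t : ℝ) (ht : 1 < t)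
    (hφ : φ.IsIncreasing t) (hψ : ψ.IsIncreasing t) (hφψ : φ.TropEquiv ψ)
    -- the approximation data and the approximated equations
    (S : RoughPDE.ApproxData n) (P Q : RoughPDE.PDEFamily α)
    (hP : S.Approximates kind (φ.relElem t) P)
    (hQ : S.Approximates kind (ψ.relElem t) Q)
    (M c : ℝ) (hM : M = max (φ.components : ℝ) (ψ.components : ℝ))
    (hc : c = max φ.lipConst ψ.lipConst) :
    (1 < c → RoughPDE.RelatedIn kind .ee ((2 * M) ^ (8 / (c - 1))) (c ^ S.k)
      (S.D : ℝ) ((S.L : ℝ) + 1) P Q) ∧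
    (c = 1 → RoughPDE.RelatedIn kind .e ((2 * M) ^ (8 * S.k)) 1
      (S.D : ℝ) ((S.L : ℝ) + 1) P Q) := by
  have hφM : (φ.components : ℝ) ≤ M := hM ▸ le_max_left _ _
  have hψM : (ψ.components : ℝ) ≤ M := hM ▸ le_max_right _ _
  have hφc : φ.lipConst ≤ c := hc ▸ le_max_left _ _
  have hψc : ψ.lipConst ≤ c := hc ▸ le_max_right _ _
  have hM1 : 1 ≤ M := le_trans (by exact_mod_cast φ.one_le_components) hφM
  have h2M : 1 ≤ 2 * M := by linarith
  have h2M0 : 0 ≤ 2 * M := by linarith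
  refine ⟨fun hc1 => ?_, fun hc1 => ?_⟩
  · have hc0 : 0 < c - 1 := by linarith
    refine RoughPDE.relatedIn_of_growthBound_le ht hφψ hP hQ hφM hψM hφc hψc
      (Real.one_le_rpow h2M (by positivity)) (one_le_pow₀ hc1.le) (fun h => by cases h) ?_
    intro r j y hr hy hj
    have hr0 : 0 ≤ r := by linarith
    have hpow : c ^ j ≤ (c ^ S.k) ^ y := by
      rw [← Real.rpow_natCast c j, ← Real.rpow_natCast c S.k, ← Real.rpow_mul (by linarith)]
      exact Real.rpow_le_rpow_of_exponent_le hc1.le hj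
    have hy0 : 0 ≤ (c ^ S.k) ^ y := by positivity
    rw [RoughPDE.GrowthKind.bound, ENNReal.ofReal_rpow_of_nonneg hr0 hy0,
      ← ENNReal.ofReal_mul (by positivity)]
    refine ENNReal.ofReal_le_ofReal (mul_le_mul ?_ (Real.rpow_le_rpow_of_exponent_le hr hpow)
      (by positivity) (by positivity))
    rw [← Real.rpow_natCast, ← Real.rpow_mul h2M0, ← Real.rpow_mul h2M0]
    refine Real.rpow_le_rpow_of_exponent_le h2M ?_
    -- The recursion yields the exponent `2 (c^j - 1) / (c - 1)`, so the constant 8 leaves room.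
    rw [geom_sum_eq hc1.ne', div_mul_eq_mul_div, ← mul_div_assoc]
    refine div_le_div_of_nonneg_right ?_ hc0.le
    push_cast
    linarith
  · subst hc1
    refine RoughPDE.relatedIn_of_growthBound_le ht hφψ hP hQ hφM hψM hφc hψc
      (one_le_pow₀ h2M) le_rfl (fun _ => rfl) ?_
    intro r j y hr hy hj
    have hr0 : 0 ≤ r := by linarith
    rw [RoughPDE.GrowthKind.bound, ← ENNReal.ofReal_mul (by positivity)]
    refine ENNReal.ofReal_le_ofReal (mul_le_mul ?_ (by simp) (by positivity) (by positivity))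
    rw [← Real.rpow_natCast, ← Real.rpow_natCast (2 * M), ← Real.rpow_mul h2M0,
      ← Real.rpow_mul h2M0]
    -- With `c = 1` the geometric sum is `j`, and `2 j ≤ 8 k y`.
    refine Real.rpow_le_rpow_of_exponent_le h2M ?_
    have : (0 : ℝ) ≤ S.k * y := by positivity
    simp
    linarith
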